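/- **Setting.** Let $n,m\ge 1$ and let $F=(f_1,\dots,f_m):\mathbb R^n\to\mathbb R^m$ be twice continuously differentiable. A point $x$ dominates $y$ if $F(x)\le F(y)$ componentwise and $F(x)\ne F(y)$; $\bar x$ is local Pareto optimal if no point of some neighbourhood of $\bar x$ dominates $\bar x$. Put $\mathcal D(x,d)=\max_j\nabla f_j(x)^\top d$, and let $\theta(x)$ and $v(x)$ be the minimum value and the minimizer over $d\in\mathbb R^n$ of $\mathcal D(x,d)+\frac12\|d\|^2$; for a nonempty $I\subsetneq\{1,\dots,m\}$ let $\theta^I(x),v^I(x)$ be the same with the maximum over $j\in I$ only. For positive definite $B_1,\dots,B_m$ the Newton-type direction at $x$ is the minimizer over $d$ of $\max_j \nabla f_j(x)^\top d+\frac12 d^\top B_jd$. For $\kappa>0$ let $v_N(x)$ be the Newton-type direction with $B_h=\nabla^2f_h(x)+\eta_h(x)I$, where $\eta_h(x)=-\lambda_{\min}(\nabla^2f_h(x))+\kappa$ if $\lambda_{\min}(\nabla^2f_h(x))\le0$ and $\eta_h(x)=0$ otherwise; the pure Newton direction is the one with $B_h=\nabla^2f_h(x)$. **Algorithm (Front Descent).**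 Inputs: a finite set $X^0$ of mutually nondominated points, $\alpha_0>0$, $\delta,\gamma\in(0,1)$, $\Gamma_1,\Gamma_2>0$, $\sigma_k\ge0$. At iteration $k$ put $\hat X=X^k$ and visit the points $x\in X^k$ one after the other, in any order. If $x\in\hat X$ at its turn, process it as follows. 1. *Refinement.* If $\theta(x)<-\sigma_k$, compute a common descent direction $v_D$; let $d=v_D$ if the safeguard $\mathcal D(x,v_D)\le-\Gamma_1\|v(x)\|^2$, $\|v_D\|\le\Gamma_2\|v(x)\|$ holds, and $d=v(x)$ otherwise; let $\alpha$ be the largest number $\alpha_0\delta^h$, $h\in\{0,1,2,\dots\}$, with $f_j(x+\alpha d)\le f_j(x)+\gamma\alpha\mathcal D(x,d)$ for all $j$. If $\theta(x)\ge-\sigma_k$, let $d=v(x)$ and $\alpha=0$. Put $z=x+\alpha d$, remove from $\hat X$ all points dominated by $z$, and add $z$. 2. *Exploration.* For each nonempty $I\subsetneq\{1,\dots,m\}$, in any order: if $\theta^I(z)<0$ and $z\in\hat X$, let $\alpha^I$ be the largest $\alpha_0\delta^h$ such that for every $y\in\hat X$ there is $j$ with $f_j(z+\alpha^Iv^I(z))<f_j(y)$;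 remove from $\hat X$ the points dominated by $z+\alpha^Iv^I(z)$ and add this point. Then $X^{k+1}=\hat X$. Write $d^k(x),\alpha^k(x),z^k(x)$ for the $d,\alpha,z$ of the point $x$ at iteration $k$. A linked sequence of an infinite execution is a sequence $x_k\in X^k$ such that $x_{k+1}$ is generated at iteration $k$ while processing $x_k$; it is refining if $x_{k+1}=z^k(x_k)$ for all large $k$. **Proposition.** Let $\sigma_k=0$ for all $k$, $\alpha_0=1$, $\gamma\in(0,\frac12)$ and $\kappa>0$. Let $\bar x$ be a local Pareto optimal point such that $\nabla^2f_h(\bar x)$ is positive definite for all $h$, and assume for some $\omega\in(0,1)$ $$\Gamma_1\le\frac{\omega^3}{2}\,\frac{\min_h\lambda_{\min}(\nabla^2f_h(\bar x))}{\max_h\lambda_{\max}^2(\nabla^2f_h(\bar x))},\qquad \Gamma_2\ge\frac1{\omega\min_h\lambda_{\min}(\nabla^2f_h(\bar x))}.$$ Then every neighbourhood of $\bar x$ contains a neighbourhood $\mathcal N(\bar x)$ of $\bar x$ for which there are $0<\rho\le r$ with $\mathcal B(\bar x,\rho)\subsetneq\mathcal N(\bar x)$ (open balls) such that the following holds for every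 refining linked sequence $\{x_k\}$ along which $v_D(x_k)=v_N(x_k)$ whenever $\theta(x_k)<0$. If $x_{\bar k}\in\mathcal B(\bar x,\rho)$ for some $\bar k$ such that $x_{k+1}=z^k(x_k)$ for all $k\ge\bar k$, then for all $k\ge\bar k$: 1. $\eta_h(x_k)=0$ for all $h$, so $v_N(x_k)$ is the pure Newton direction at $x_k$; 2. $v_N(x_k)$ satisfies the safeguard at $x_k$, and $d^k(x_k)=v_N(x_k)$; 3. if $\theta(x_k)<0$ (that is, if $x_k$ is not Pareto-stationary, so that the line search is carried out), then $\alpha^k(x_k)=1$; 4. $x_k\in\mathcal B(x_{\bar k},r)\subsetneq\mathcal N(\bar x)$. Furthermore $\{x_k\}$ converges superlinearly, i.e. $\|x_{k+1}-x^\star\|=o(\|x_k-x^\star\|)$, to a local Pareto optimal point $x^\star\in\mathcal B(x_{\bar k},r)$. If in addition all $\nabla^2f_h$ are Lipschitz continuous on $\mathcal N(\bar x)$, the convergence is quadratic, i.e. $\|x_{k+1}-x^\star\|=O(\|x_k-x^\star\|^2)$. -/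

import Mathlib

open Filter Topology Asymptotics

noncomputable section

namespace FrontDescent

/-- The decision space `ℝⁿ` with its Euclidean norm. -/
abbrev Vec (n : ℕ) : Type := EuclideanSpace ℝ (Fin n)

variable {n m : ℕ}

/-! ### Pareto optimality -/

/-- `x` dominates `y`: `F(x) ≤ F(y)` componentwise and `F(x) ≠ F(y)`, where `F = (f₁, …, f_m)`. -/
def Dominates (f : Fin m → Vec n → ℝ) (x y : Vec n) : Prop :=
  (∀ j, f j x ≤ f j y) ∧ ∃ j, f j x ≠ f j y

/-- No point near `x` dominates `x`. -/
def IsLocalParetoOptimal (f : Fin m → Vec n → ℝ) (x : Vec n) : Prop :=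
  ∃ V ∈ 𝓝 x, ∀ y ∈ V, ¬ Dominates f y x

/-- `d` is a descent direction at `x` for every objective. -/
def IsCommonDescentDir (f : Fin m → Vec n → ℝ) (x d : Vec n) : Prop :=
  ∀ j, ∃ t > 0, ∀ a : ℝ, 0 < a → a < t → f j (x + a • d) < f j x

/-! ### Search directions -/

/-- A global minimizer of `φ`; it is only used for strongly convex continuous `φ`, for which the
minimizer exists and is unique. -/
def argmin (φ : Vec n → ℝ) : Vec n :=
  Classical.epsilon fun d => ∀ y, φ d ≤ φ y

/-- `𝒟(x,d) = max_j ∇f_j(x)ᵀ d`. -/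
def maxSlope (f : Fin m → Vec n → ℝ) (x d : Vec n) : ℝ :=
  ⨆ j : Fin m, inner ℝ (gradient (f j) x) d

/-- `max_j ∇f_j(x)ᵀ d + ‖d‖² / 2`. -/
def steepestModel (f : Fin m → Vec n → ℝ) (x d : Vec n) : ℝ :=
  maxSlope f x d + 1 / 2 * ‖d‖ ^ 2

/-- `θ(x)`, the optimal value of the steepest common descent problem. -/
def theta (f : Fin m → Vec n → ℝ) (x : Vec n) : ℝ :=
  ⨅ d : Vec n, steepestModel f x d

/-- `v(x)`, the steepest common descent direction. -/
def steepestDir (f : Fin m → Vec n → ℝ) (x : Vec n) : Vec n :=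
  argmin (steepestModel f x)

/-- `max_{j ∈ I} ∇f_j(x)ᵀ d + ‖d‖² / 2` (used for nonempty `I` only). -/
def partialModel (f : Fin m → Vec n → ℝ) (I : Finset (Fin m)) (x d : Vec n) : ℝ :=
  (⨆ j : I, inner ℝ (gradient (f j) x) d) + 1 / 2 * ‖d‖ ^ 2

/-- `θ^I(x)`. -/
def partialTheta (f : Fin m → Vec n → ℝ) (I : Finset (Fin m)) (x : Vec n) : ℝ :=
  ⨅ d : Vec n, partialModel f I x d

/-- `v^I(x)`, the steepest partial descent direction. -/
def partialDir (f : Fin m → Vec n → ℝ) (I : Finset (Fin m)) (x : Vec n) : Vec n :=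
  argmin (partialModel f I x)

/-- The Hessian `∇²g(x)`, as an operator on `ℝⁿ`. -/
def hess (g : Vec n → ℝ) (x : Vec n) : Vec n →L[ℝ] Vec n :=
  fderiv ℝ (gradient g) x

/-- The smallest eigenvalue (of a symmetric operator). -/
def lambdaMin (A : Vec n →L[ℝ] Vec n) : ℝ :=
  sInf {μ : ℝ | Module.End.HasEigenvalue A.toLinearMap μ}

/-- The largest eigenvalue (of a symmetric operator). -/
def lambdaMax (A : Vec n →L[ℝ] Vec n) : ℝ :=
  sSup {μ : ℝ | Module.End.HasEigenvalue A.toLinearMap μ}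

/-- The Newton-type direction `argmin_d max_j ∇f_j(x)ᵀ d + dᵀ B_j d / 2`. -/
def newtonTypeDir (f : Fin m → Vec n → ℝ) (B : Fin m → Vec n →L[ℝ] Vec n) (x : Vec n) : Vec n :=
  argmin fun d => ⨆ j : Fin m, (inner ℝ (gradient (f j) x) d + 1 / 2 * inner ℝ d (B j d))

/-- The pure Newton direction: `B_j = ∇²f_j(x)`. -/
def newtonDir (f : Fin m → Vec n → ℝ) (x : Vec n) : Vec n :=
  newtonTypeDir f (fun j => hess (f j) x) x

/-- The regularization `η` of the Hessian of `g` at `x`. -/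
def eta (κ : ℝ) (g : Vec n → ℝ) (x : Vec n) : ℝ :=
  if lambdaMin (hess g x) ≤ 0 then - lambdaMin (hess g x) + κ else 0

/-- The regularized Newton direction: `B_j = ∇²f_j(x) + η_j I`. -/
def regNewtonDir (κ : ℝ) (f : Fin m → Vec n → ℝ) (x : Vec n) : Vec n :=
  newtonTypeDir f
    (fun j => hess (f j) x + eta κ (f j) x • ContinuousLinearMap.id ℝ (Vec n)) x

/-! ### The Front Descent algorithm -/

/-- The scalar inputs of the algorithm. -/
structure Params where
  α₀ : ℝ
  δ : ℝ
  γ : ℝ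
  Γ₁ : ℝ
  Γ₂ : ℝ
  σ : ℕ → ℝ
  α₀_pos : 0 < α₀
  δ_pos : 0 < δ
  δ_lt_one : δ < 1
  γ_pos : 0 < γ
  γ_lt_one : γ < 1
  Γ₁_pos : 0 < Γ₁
  Γ₂_pos : 0 < Γ₂
  σ_nonneg : ∀ k, 0 ≤ σ k

/-- The safeguard test on a tentative direction `d` at `x`. -/
def PassesSafeguard (f : Fin m → Vec n → ℝ) (p : Params) (x d : Vec n) : Prop :=
  maxSlope f x d ≤ - p.Γ₁ * ‖steepestDir f x‖ ^ 2 ∧ ‖d‖ ≤ p.Γ₂ * ‖steepestDir f x‖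

open Classical in
/-- The direction `d_c` used at iteration `k` for the point `x`, the tentative direction being `vD`;
it is `v(x)` if `x` fails the test `θ(x) < -σ_k`, or if `vD` fails the safeguard. -/
def refineDir (f : Fin m → Vec n → ℝ) (p : Params) (k : ℕ) (vD x : Vec n) : Vec n :=
  if theta f x < - p.σ k ∧ PassesSafeguard f p x vD then vD else steepestDir f x

/-- `α` is the step size chosen at iteration `k` for the point `x` along `d`: the largest
`α₀ δ^h` with Armijo decrease of all objectives if `θ(x) < -σ_k`, and `0` otherwise. -/
def IsRefineStep (f : Fin m → Vec n → ℝ) (p : Params) (k : ℕ) (x d : Vec n) (α : ℝ) : Prop :=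
  (theta f x < - p.σ k →
    IsGreatest {a : ℝ | (∃ h : ℕ, a = p.α₀ * p.δ ^ h) ∧
      ∀ j, f j (x + a • d) ≤ f j x + p.γ * a * maxSlope f x d} α) ∧
  (¬ theta f x < - p.σ k → α = 0)

/-- Remove from `Y` the points dominated by `z`, then add `z`. -/
def addPoint (f : Fin m → Vec n → ℝ) (Y : Set (Vec n)) (z : Vec n) : Set (Vec n) :=
  (Y \ {y | Dominates f z y}) ∪ {z}

/-- `ExploreLoop f p z Is Y Y' G`: the exploration steps from `z` for the index sets in the list
`Is`, in this order, turn the current set `Y` into `Y'`; `G` is the set of the points that are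
inserted on the way. -/
inductive ExploreLoop (f : Fin m → Vec n → ℝ) (p : Params) (z : Vec n) :
    List (Finset (Fin m)) → Set (Vec n) → Set (Vec n) → Set (Vec n) → Prop
  | nil (Y : Set (Vec n)) : ExploreLoop f p z [] Y Y ∅
  | skip (I : Finset (Fin m)) (Is : List (Finset (Fin m))) (Y Y' G : Set (Vec n)) :
      ¬ (partialTheta f I z < 0 ∧ z ∈ Y) → ExploreLoop f p z Is Y Y' G →
      ExploreLoop f p z (I :: Is) Y Y' G
  | step (I : Finset (Fin m)) (Is : List (Finset (Fin m))) (Y Y' G : Set (Vec n)) (α : ℝ) :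
      partialTheta f I z < 0 → z ∈ Y →
      IsGreatest {a : ℝ | (∃ h : ℕ, a = p.α₀ * p.δ ^ h) ∧
        ∀ y ∈ Y, ∃ j, f j (z + a • partialDir f I z) < f j y} α →
      ExploreLoop f p z Is (addPoint f Y (z + α • partialDir f I z)) Y' G →
      ExploreLoop f p z (I :: Is) Y Y' (insert (z + α • partialDir f I z) G)

/-- `PointLoop f p k vD α L Y Y' G`: processing at iteration `k` the points of the list `L`, in
this order, turns the current set `Y` into `Y'`. The tentative direction and the step size used for
a processed point `x` are `vD x` and `α x`, and `G x w` says that `w` is generated while `x` is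
processed. -/
inductive PointLoop (f : Fin m → Vec n → ℝ) (p : Params) (k : ℕ)
    (vD : Vec n → Vec n) (α : Vec n → ℝ) :
    List (Vec n) → Set (Vec n) → Set (Vec n) → (Vec n → Vec n → Prop) → Prop
  | nil (Y : Set (Vec n)) : PointLoop f p k vD α [] Y Y (fun _ _ => False)
  | skip (x : Vec n) (L : List (Vec n)) (Y Y' : Set (Vec n)) (G : Vec n → Vec n → Prop) :
      x ∉ Y → PointLoop f p k vD α L Y Y' G → PointLoop f p k vD α (x :: L) Y Y' G
  | process (x z : Vec n) (L : List (Vec n)) (Is : List (Finset (Fin m)))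
      (Y Y₁ Y' G₁ : Set (Vec n)) (G : Vec n → Vec n → Prop) :
      x ∈ Y →
      (theta f x < - p.σ k → IsCommonDescentDir f x (vD x)) →
      IsRefineStep f p k x (refineDir f p k (vD x) x) (α x) →
      z = x + α x • refineDir f p k (vD x) x →
      Is.Nodup → (∀ I, I ∈ Is ↔ I.Nonempty ∧ I ≠ Finset.univ) →
      ExploreLoop f p z Is (addPoint f Y z) Y₁ G₁ →
      PointLoop f p k vD α L Y₁ Y' G →
      PointLoop f p k vD α (x :: L) Y Y' (fun u w => (u = x ∧ (w = z ∨ w ∈ G₁)) ∨ G u w)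

/-- An infinite execution of the algorithm on `f`, from a finite set of mutually nondominated
points, with an arbitrary processing order at each iteration. -/
structure Run (f : Fin m → Vec n → ℝ) (p : Params) where
  /-- the sets `X^k` -/
  X : ℕ → Set (Vec n)
  /-- the order in which the points of `X^k` are visited -/
  order : ℕ → List (Vec n)
  /-- the tentative direction computed at iteration `k` for a point -/
  vD : ℕ → Vec n → Vec n
  /-- the step size `α_c^k` of the refinement step at iteration `k` for a point -/
  α : ℕ → Vec n → ℝ
  /-- `generated k x w`: at iteration `k`, `w` is generated while `x` is processed -/
  generated : ℕ → Vec n → Vec n → Prop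
  nondominated : ∀ x ∈ X 0, ∀ y ∈ X 0, ¬ Dominates f x y
  order_nodup : ∀ k, (order k).Nodup
  mem_order : ∀ k x, x ∈ order k ↔ x ∈ X k
  iterate : ∀ k, PointLoop f p k (vD k) (α k) (order k) (X k) (X (k + 1)) (generated k)

namespace Run

variable {f : Fin m → Vec n → ℝ} {p : Params}

/-- The direction `d_c` used in the refinement step for `x` at iteration `k`. -/
def dir (R : Run f p) (k : ℕ) (x : Vec n) : Vec n := refineDir f p k (R.vD k x) x

/-- The point `z_c^k` produced by the refinement step for `x` at iteration `k`. -/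
def refined (R : Run f p) (k : ℕ) (x : Vec n) : Vec n := x + R.α k x • R.dir k x

/-- Linked sequence: `x_{k+1} ∈ X^{k+1}` is generated at iteration `k` while processing
`x_k ∈ X^k`. -/
def IsLinked (R : Run f p) (x : ℕ → Vec n) : Prop :=
  ∀ k, x k ∈ R.X k ∧ R.generated k (x k) (x (k + 1))

/-- Refining linked sequence: eventually all steps are refinement steps. -/
def IsRefining (R : Run f p) (x : ℕ → Vec n) : Prop :=
  R.IsLinked x ∧ ∃ k₀, ∀ k ≥ k₀, x (k + 1) = R.refined k (x k)

end Run

/-! ### Rates of convergence -/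

/-- `x k → y` with `‖x (k+1) - y‖ = o(‖x k - y‖)`. -/
def ConvergesSuperlinearly (x : ℕ → Vec n) (y : Vec n) : Prop :=
  Tendsto x atTop (𝓝 y) ∧ (fun k => ‖x (k + 1) - y‖) =o[atTop] (fun k => ‖x k - y‖)

/-- `x k → y` with `‖x (k+1) - y‖ = O(‖x k - y‖²)`. -/
def ConvergesQuadratically (x : ℕ → Vec n) (y : Vec n) : Prop :=
  Tendsto x atTop (𝓝 y) ∧ (fun k => ‖x (k + 1) - y‖) =O[atTop] (fun k => ‖x k - y‖ ^ 2)

end FrontDescent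

end

open FrontDescent

/-! Near `xbar` the Hessians are uniformly positive definite, so the Newton direction minimizes a
strongly convex maximum of quadratics. What is needed about it follows from comparing model values
and from one directional optimality condition, without multipliers.

The driving fact is `exists_neg_le_inner_gradient_newton_step`. Optimality of the Newton direction
`s` at `x` says that for every `d` some predicted gradient `∇f_j(x) + ∇²f_j(x) s` has nonnegative
inner product with `d`. The true gradients at `x + s` differ from these predictions by a Taylor
error of at most `ε ‖s‖`, so `x + s` is almost stationary, and `mul_norm_newtonDir_le` turns this
into `a ‖s⁺‖ ≤ ε ‖s‖` for the next Newton direction `s⁺`.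

With `4 * ε ≤ a` the steps shrink by a factor of four. Since `xbar` is stationary, the first step is
small, so the iterates stay in the ball and converge; the limit is stationary, and positive
curvature makes it locally Pareto optimal. Step length and distance to the limit agree up to a
factor of two, so the finer Taylor errors, `o(‖s‖)` or `O(‖s‖²)`, become the convergence rates.

The same model comparisons give the safeguard (`passesSafeguard_newtonDir`) and Armijo decrease for
the unit step (`newtonDir_armijo`). Hence a refinement step is exactly a Newton step, also where `θ`
is not negative, because there both directions vanish. -/

noncomputable section

namespace FrontDescent

variable {n m : ℕ}

/-! ### Minimizers of a finite maximum of quadratic models -/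

/-- `max_j g_jᵀ d`. -/
def maxInner (g : Fin m → Vec n) (d : Vec n) : ℝ :=
  ⨆ j : Fin m, inner ℝ (g j) d

/-- `max_j g_jᵀ d + dᵀ H_j d / 2`. -/
def quadModel (g : Fin m → Vec n) (H : Fin m → Vec n →L[ℝ] Vec n) (d : Vec n) : ℝ :=
  ⨆ j : Fin m, (inner ℝ (g j) d + 1 / 2 * inner ℝ d (H j d))

lemma le_iSup_fin (a : Fin m → ℝ) (j : Fin m) : a j ≤ ⨆ j, a j :=
  le_ciSup (Set.finite_range a).bddAbove j

lemma inner_le_maxInner (g : Fin m → Vec n) (d : Vec n) (j : Fin m) :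
    inner ℝ (g j) d ≤ maxInner g d :=
  le_iSup_fin (fun j => inner ℝ (g j) d) j

lemma le_quadModel (g : Fin m → Vec n) (H : Fin m → Vec n →L[ℝ] Vec n) (d : Vec n) (j : Fin m) :
    inner ℝ (g j) d + 1 / 2 * inner ℝ d (H j d) ≤ quadModel g H d :=
  le_iSup_fin (fun j => inner ℝ (g j) d + 1 / 2 * inner ℝ d (H j d)) j

section

variable [NeZero m] {g : Fin m → Vec n} {H : Fin m → Vec n →L[ℝ] Vec n} {a A : ℝ} {s v : Vec n}

lemma maxInner_le {c : ℝ} {d : Vec n} (h : ∀ j, inner ℝ (g j) d ≤ c) : maxInner g d ≤ c :=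
  ciSup_le h

lemma quadModel_le {c : ℝ} {d : Vec n}
    (h : ∀ j, inner ℝ (g j) d + 1 / 2 * inner ℝ d (H j d) ≤ c) : quadModel g H d ≤ c :=
  ciSup_le h

lemma quadModel_zero : quadModel g H 0 = 0 := by
  simp [quadModel]

lemma continuous_quadModel : Continuous (quadModel g H) := by
  have : quadModel g H = fun d => Finset.univ.sup' Finset.univ_nonempty
      fun j => inner ℝ (g j) d + 1 / 2 * inner ℝ d (H j d) := by
    funext d
    rw [Finset.sup'_univ_eq_ciSup]
    rfl
  rw [this]
  exact Continuous.finset_sup'_apply _ fun j _ => by fun_prop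

lemma quadModel_id (d : Vec n) :
    quadModel g (fun _ => ContinuousLinearMap.id ℝ (Vec n)) d = maxInner g d + 1 / 2 * ‖d‖ ^ 2 := by
  apply le_antisymm
  · refine quadModel_le fun j => ?_
    have := inner_le_maxInner g d j
    simp only [ContinuousLinearMap.id_apply, real_inner_self_eq_norm_sq]
    linarith
  · have : maxInner g d ≤ quadModel g (fun _ => ContinuousLinearMap.id ℝ (Vec n)) d
        - 1 / 2 * ‖d‖ ^ 2 := by
      refine maxInner_le fun j => ?_
      have := le_quadModel g (fun _ => ContinuousLinearMap.id ℝ (Vec n)) d j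
      simp only [ContinuousLinearMap.id_apply, real_inner_self_eq_norm_sq] at this
      linarith
    linarith

/-- By continuity a bounded sublevel set suffices. Where the model is at most its value `0` at the
origin, the single piece of index `0` already forces `a / 2 * ‖d‖ ≤ ‖g 0‖`. -/
lemma exists_forall_quadModel_le (ha : 0 < a)
    (hH : ∀ j d, a * ‖d‖ ^ 2 ≤ inner ℝ d (H j d)) :
    ∃ s, ∀ y, quadModel g H s ≤ quadModel g H y := by
  refine continuous_quadModel.exists_forall_le_of_isBounded 0 ?_
  refine (Metric.isBounded_closedBall (x := (0 : Vec n)) (r := 2 * ‖g 0‖ / a)).subset ?_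
  intro d hd
  rw [Set.mem_ofPred_eq, quadModel_zero] at hd
  have h1 := (le_quadModel g H d 0).trans hd
  have h2 := hH 0 d
  have h3 := neg_le_of_abs_le (abs_real_inner_le_norm (g 0) d)
  rw [mem_closedBall_zero_iff, le_div_iff₀ ha]
  rcases (norm_nonneg d).eq_or_lt with h | h
  · rw [← h]; simp
  · refine le_of_mul_le_mul_right ?_ h
    nlinarith

lemma maxInner_add_le_quadModel (hH : ∀ j d, a * ‖d‖ ^ 2 ≤ inner ℝ d (H j d)) (d : Vec n) :
    maxInner g d + a / 2 * ‖d‖ ^ 2 ≤ quadModel g H d := by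
  have : maxInner g d ≤ quadModel g H d - a / 2 * ‖d‖ ^ 2 :=
    maxInner_le fun j => by linarith [le_quadModel g H d j, hH j d]
  linarith

/-- Strong convexity on the segment from `s` to the origin, where the model vanishes: compare `s`
with `(1 - t) • s`, divide by `t`, and let `t → 0`. -/
lemma quadModel_le_neg_norm_sq (hs : ∀ y, quadModel g H s ≤ quadModel g H y)
    (hH : ∀ j d, a * ‖d‖ ^ 2 ≤ inner ℝ d (H j d)) :
    quadModel g H s ≤ - (a / 2) * ‖s‖ ^ 2 := by
  have key : ∀ t ∈ Set.Ioo (0 : ℝ) 1, quadModel g H s ≤ -((1 - t) * (a / 2) * ‖s‖ ^ 2) := by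
    rintro t ⟨h0, h1⟩
    have h : quadModel g H ((1 - t) • s) ≤
        (1 - t) * quadModel g H s - t * (1 - t) * (a / 2) * ‖s‖ ^ 2 := by
      refine quadModel_le fun j => ?_
      simp only [map_smul, inner_smul_left, inner_smul_right, conj_trivial]
      have e1 := mul_le_mul_of_nonneg_left (le_quadModel g H s j) (sub_nonneg.2 h1.le)
      have e2 := mul_le_mul_of_nonneg_left (hH j s) (mul_nonneg h0.le (sub_nonneg.2 h1.le))
      linarith
    have h' : t * quadModel g H s ≤ t * -((1 - t) * (a / 2) * ‖s‖ ^ 2) := by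
      linarith [(hs ((1 - t) • s)).trans h]
    exact le_of_mul_le_mul_left h' h0
  have hlim : Tendsto (fun t : ℝ => -((1 - t) * (a / 2) * ‖s‖ ^ 2)) (𝓝[>] 0)
      (𝓝 (-((1 - 0) * (a / 2) * ‖s‖ ^ 2))) :=
    (Continuous.tendsto (by fun_prop) 0).mono_left nhdsWithin_le_nhds
  have := ge_of_tendsto hlim (eventually_of_mem (Ioo_mem_nhdsGT one_pos) key)
  linarith

/-- The same comparison, with each piece at `(1 - t) • s` split as `(1 - t)²` times its value at `s`
plus `t (1 - t)` times its slope; no curvature bound enters. The factor `2` is why Armijo decrease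
needs `γ < 1/2`. -/
lemma two_mul_quadModel_le_maxInner (hs : ∀ y, quadModel g H s ≤ quadModel g H y) :
    2 * quadModel g H s ≤ maxInner g s := by
  have key : ∀ t ∈ Set.Ioo (0 : ℝ) 1, (2 - t) * quadModel g H s ≤ (1 - t) * maxInner g s := by
    rintro t ⟨h0, h1⟩
    have h : quadModel g H ((1 - t) • s) ≤
        (1 - t) ^ 2 * quadModel g H s + t * (1 - t) * maxInner g s := by
      refine quadModel_le fun j => ?_
      simp only [map_smul, inner_smul_left, inner_smul_right, conj_trivial]
      have e1 := mul_le_mul_of_nonneg_left (le_quadModel g H s j) (sq_nonneg (1 - t))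
      have e2 := mul_le_mul_of_nonneg_left (inner_le_maxInner g s j)
        (mul_nonneg h0.le (sub_nonneg.2 h1.le))
      linarith
    have h' : t * ((2 - t) * quadModel g H s) ≤ t * ((1 - t) * maxInner g s) := by
      linarith [(hs ((1 - t) • s)).trans h]
    exact le_of_mul_le_mul_left h' h0
  have hl : Tendsto (fun t : ℝ => (2 - t) * quadModel g H s) (𝓝[>] 0)
      (𝓝 ((2 - 0) * quadModel g H s)) :=
    (Continuous.tendsto (by fun_prop) 0).mono_left nhdsWithin_le_nhds
  have hr : Tendsto (fun t : ℝ => (1 - t) * maxInner g s) (𝓝[>] 0)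
      (𝓝 ((1 - 0) * maxInner g s)) :=
    (Continuous.tendsto (by fun_prop) 0).mono_left nhdsWithin_le_nhds
  have := le_of_tendsto_of_tendsto hl hr (eventually_of_mem (Ioo_mem_nhdsGT one_pos) key)
  linarith

/-- If all these slopes were negative, a short move along `d` would lower every piece at once,
active or not. The indices `j₀` and `j₁` make the first- and second-order terms uniform over the
pieces. -/
lemma exists_inner_nonneg_of_isMin (hs : ∀ y, quadModel g H s ≤ quadModel g H y)
    (hsymm : ∀ j u w, inner ℝ (H j u) w = inner ℝ u (H j w)) (d : Vec n) :
    ∃ j, 0 ≤ inner ℝ (g j + H j s) d := by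
  obtain ⟨j₀, hj₀⟩ := Finite.exists_max fun j => inner ℝ (g j + H j s) d
  obtain ⟨j₁, hj₁⟩ := Finite.exists_max fun j => inner ℝ d (H j d)
  refine ⟨j₀, ?_⟩
  have key : ∀ t ∈ Set.Ioo (0 : ℝ) 1,
      0 ≤ inner ℝ (g j₀ + H j₀ s) d + t / 2 * inner ℝ d (H j₁ d) := by
    rintro t ⟨h0, h1⟩
    have h : quadModel g H (s + t • d) ≤ quadModel g H s +
        t * (inner ℝ (g j₀ + H j₀ s) d + t / 2 * inner ℝ d (H j₁ d)) := by
      refine quadModel_le fun j => ?_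
      have e1 := mul_le_mul_of_nonneg_left (hj₀ j) h0.le
      have e2 := mul_le_mul_of_nonneg_left (hj₁ j) (sq_nonneg t)
      have e3 := le_quadModel g H s j
      have e4 : inner ℝ s (H j d) = inner ℝ d (H j s) := by
        rw [← hsymm, real_inner_comm]
      have e5 : inner ℝ (g j + H j s) d = inner ℝ (g j) d + inner ℝ d (H j s) := by
        rw [inner_add_left, real_inner_comm d (H j s)]
      simp only [map_add, map_smul, inner_add_left, inner_add_right, inner_smul_left,
        inner_smul_right, conj_trivial, e4] at e1 e2 e3 e5 ⊢
      nlinarith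
    have h' : t * 0 ≤ t * (inner ℝ (g j₀ + H j₀ s) d + t / 2 * inner ℝ d (H j₁ d)) := by
      linarith [(hs (s + t • d)).trans h]
    exact le_of_mul_le_mul_left h' h0
  have hlim : Tendsto (fun t : ℝ => inner ℝ (g j₀ + H j₀ s) d + t / 2 * inner ℝ d (H j₁ d))
      (𝓝[>] 0) (𝓝 (inner ℝ (g j₀ + H j₀ s) d + 0 / 2 * inner ℝ d (H j₁ d))) :=
    (Continuous.tendsto (by fun_prop) 0).mono_left nhdsWithin_le_nhds
  have := ge_of_tendsto hlim (eventually_of_mem (Ioo_mem_nhdsGT one_pos) key)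
  linarith

lemma maxInner_add_norm_sq_le (hv : ∀ y, maxInner g v + 1 / 2 * ‖v‖ ^ 2 ≤
    maxInner g y + 1 / 2 * ‖y‖ ^ 2) : maxInner g v ≤ - ‖v‖ ^ 2 := by
  have := quadModel_le_neg_norm_sq (a := 1) (g := g) (s := v)
    (H := fun _ => ContinuousLinearMap.id ℝ (Vec n)) (by simpa only [quadModel_id] using hv)
    (fun j d => by simp)
  rw [quadModel_id] at this
  linarith

lemma neg_inner_le_maxInner (hv : ∀ y, maxInner g v + 1 / 2 * ‖v‖ ^ 2 ≤
    maxInner g y + 1 / 2 * ‖y‖ ^ 2) (d : Vec n) : - inner ℝ v d ≤ maxInner g d := by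
  obtain ⟨j, hj⟩ := exists_inner_nonneg_of_isMin (g := g) (s := v)
    (H := fun _ => ContinuousLinearMap.id ℝ (Vec n)) (by simpa only [quadModel_id] using hv)
    (fun j u w => by simp) d
  have := inner_le_maxInner g d j
  rw [inner_add_left] at hj
  simp only [ContinuousLinearMap.id_apply] at hj
  linarith

/-- Approximate stationarity tested at `d = v`: `-c ‖v‖ ≤ max_j g_jᵀ v ≤ -‖v‖²`. -/
lemma norm_le_of_forall_exists_inner (hv : ∀ y, maxInner g v + 1 / 2 * ‖v‖ ^ 2 ≤
    maxInner g y + 1 / 2 * ‖y‖ ^ 2) {c : ℝ} (hc : 0 ≤ c)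
    (h : ∀ d, ∃ j, - (c * ‖d‖) ≤ inner ℝ (g j) d) : ‖v‖ ≤ c := by
  obtain ⟨j, hj⟩ := h v
  have h1 := inner_le_maxInner g v j
  have h2 := maxInner_add_norm_sq_le hv
  rcases (norm_nonneg v).eq_or_lt with h | h
  · rwa [← h]
  · exact le_of_mul_le_mul_right (by nlinarith) h

/-- The chain is `-vᵀs ≤ max_j g_jᵀ s ≤ quadModel g H s - a / 2 * ‖s‖² ≤ -a ‖s‖²`, followed by
Cauchy–Schwarz. This yields the norm half of the safeguard. -/
lemma mul_norm_le_of_isMin (hv : ∀ y, maxInner g v + 1 / 2 * ‖v‖ ^ 2 ≤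
    maxInner g y + 1 / 2 * ‖y‖ ^ 2) (hs : ∀ y, quadModel g H s ≤ quadModel g H y)
    (hH : ∀ j d, a * ‖d‖ ^ 2 ≤ inner ℝ d (H j d)) : a * ‖s‖ ≤ ‖v‖ := by
  have h1 := quadModel_le_neg_norm_sq hs hH
  have h2 := maxInner_add_le_quadModel (g := g) hH s
  have h3 := neg_inner_le_maxInner hv s
  have h4 := real_inner_le_norm v s
  rcases (norm_nonneg s).eq_or_lt with h | h
  · rw [← h]; simp
  · exact le_of_mul_le_mul_right (by nlinarith) h

/-- The trial point `v / A` bounds the optimal model value, since `-1/A + 1/(2A) = -1/(2A)`. This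
yields the slope half of the safeguard. -/
lemma maxInner_le_of_isMin (hA : 0 < A) (ha : 0 ≤ a) (hv : ∀ y, maxInner g v + 1 / 2 * ‖v‖ ^ 2 ≤
    maxInner g y + 1 / 2 * ‖y‖ ^ 2) (hs : ∀ y, quadModel g H s ≤ quadModel g H y)
    (hH : ∀ j d, a * ‖d‖ ^ 2 ≤ inner ℝ d (H j d))
    (hH' : ∀ j d, inner ℝ d (H j d) ≤ A * ‖d‖ ^ 2) :
    maxInner g s ≤ - (1 / (2 * A)) * ‖v‖ ^ 2 := by
  have h1 := maxInner_add_le_quadModel (g := g) hH s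
  have h2 : quadModel g H ((1 / A) • v) ≤ - (1 / (2 * A)) * ‖v‖ ^ 2 := by
    refine quadModel_le fun j => ?_
    have e1 := hH' j ((1 / A) • v)
    have e2 := (inner_le_maxInner g v j).trans (maxInner_add_norm_sq_le hv)
    have e3 := mul_le_mul_of_nonneg_left e2 (one_div_pos.2 hA).le
    rw [norm_smul, mul_pow, Real.norm_eq_abs, sq_abs] at e1
    have e4 : A * ((1 / A) ^ 2 * ‖v‖ ^ 2) = 1 / A * ‖v‖ ^ 2 := by field_simp
    have e5 : - (1 / (2 * A)) * ‖v‖ ^ 2 = - (1 / A * ‖v‖ ^ 2) / 2 := by field_simp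
    rw [inner_smul_right, e5]
    linarith
  have h3 : 0 ≤ a / 2 * ‖s‖ ^ 2 := by positivity
  linarith [hs ((1 / A) • v)]

end

/-! ### Hessians and their extreme eigenvalues -/

lemma contDiff_gradient {g : Vec n → ℝ} (hg : ContDiff ℝ 2 g) : ContDiff ℝ 1 (gradient g) :=
  (InnerProductSpace.toDual ℝ (Vec n)).symm.contDiff.comp
    (hg.fderiv_right (m := 1) (by norm_num [one_add_one_eq_two]))

lemma hasFDerivAt_gradient {g : Vec n → ℝ} (hg : ContDiff ℝ 2 g) (x : Vec n) :
    HasFDerivAt (gradient g) (hess g x) x :=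
  ((contDiff_gradient hg).differentiable one_ne_zero x).hasFDerivAt

lemma continuous_hess {g : Vec n → ℝ} (hg : ContDiff ℝ 2 g) : Continuous (hess g) :=
  (contDiff_gradient hg).continuous_fderiv one_ne_zero

lemma inner_hess_comm {g : Vec n → ℝ} (hg : ContDiff ℝ 2 g) (x u w : Vec n) :
    inner ℝ (hess g x u) w = inner ℝ u (hess g x w) := by
  have hsymm : IsSymmSndFDerivAt ℝ g x :=
    hg.contDiffAt.isSymmSndFDerivAt (by simp)
  have key : ∀ u w : Vec n, inner ℝ (hess g x u) w = fderiv ℝ (fderiv ℝ g) x u w := by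
    intro u w
    have h1 : HasFDerivAt (fderiv ℝ g) (fderiv ℝ (fderiv ℝ g) x) x :=
      ((hg.fderiv_right (m := 1) (by norm_num [one_add_one_eq_two])).differentiable
        one_ne_zero x).hasFDerivAt
    have h2 := ((InnerProductSpace.toDual ℝ (Vec n)).symm.toContinuousLinearEquiv.hasFDerivAt
      (x := fderiv ℝ g x)).comp x h1
    have h3 : hess g x u = (InnerProductSpace.toDual ℝ (Vec n)).symm
        (fderiv ℝ (fderiv ℝ g) x u) := by
      rw [show hess g x = _ from h2.fderiv]
      rfl
    rw [h3, InnerProductSpace.toDual_symm_apply]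
  rw [key, real_inner_comm, key, hsymm.eq]

lemma abs_inner_sub_le {B C : Vec n →L[ℝ] Vec n} {ε : ℝ} (h : ‖B - C‖ ≤ ε) (d : Vec n) :
    |inner ℝ d (B d) - inner ℝ d (C d)| ≤ ε * ‖d‖ ^ 2 := by
  rw [← inner_sub_right, ← sub_apply]
  calc |inner ℝ d ((B - C) d)| ≤ ‖d‖ * ‖(B - C) d‖ := abs_real_inner_le_norm _ _
    _ ≤ ‖d‖ * (ε * ‖d‖) := by gcongr; exact (B - C).le_of_opNorm_le h d
    _ = ε * ‖d‖ ^ 2 := by ring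

section Eigenvalues

variable {A : Vec n →L[ℝ] Vec n}

lemma lambdaMin_le_of_hasEigenvalue {μ : ℝ} (h : Module.End.HasEigenvalue A.toLinearMap μ) :
    lambdaMin A ≤ μ :=
  csInf_le (Module.End.finite_hasEigenvalue A.toLinearMap).bddBelow h

lemma le_lambdaMax_of_hasEigenvalue {μ : ℝ} (h : Module.End.HasEigenvalue A.toLinearMap μ) :
    μ ≤ lambdaMax A :=
  le_csSup (Module.End.finite_hasEigenvalue A.toLinearMap).bddAbove h

variable [NeZero n] (hA : ∀ u w, inner ℝ (A u) w = inner ℝ u (A w))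
include hA

/-- For a symmetric operator the infimum of the Rayleigh quotient is itself an eigenvalue, hence at
least `lambdaMin A`. -/
lemma lambdaMin_mul_le (d : Vec n) : lambdaMin A * ‖d‖ ^ 2 ≤ inner ℝ d (A d) := by
  rcases eq_or_ne d 0 with rfl | hd
  · simp
  have h1 := lambdaMin_le_of_hasEigenvalue
    (LinearMap.IsSymmetric.hasEigenvalue_iInf_of_finiteDimensional
      (T := A.toLinearMap) fun u w => hA u w)
  have hb : BddBelow (Set.range fun x : {x : Vec n // x ≠ 0} =>
      (RCLike.re (inner ℝ (A.toLinearMap x) (x : Vec n)) / ‖(x : Vec n)‖ ^ 2 : ℝ)) := by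
    refine ⟨-‖A‖, ?_⟩
    rintro _ ⟨x, rfl⟩
    exact neg_le_of_abs_le (A.rayleighQuotient_le_norm x)
  have h2 := h1.trans (ciInf_le hb ⟨d, hd⟩)
  have h3 : 0 < ‖d‖ ^ 2 := by positivity
  rw [le_div_iff₀ h3] at h2
  rw [real_inner_comm]
  exact h2

lemma le_lambdaMax_mul (d : Vec n) : inner ℝ d (A d) ≤ lambdaMax A * ‖d‖ ^ 2 := by
  rcases eq_or_ne d 0 with rfl | hd
  · simp
  have h1 := le_lambdaMax_of_hasEigenvalue
    (LinearMap.IsSymmetric.hasEigenvalue_iSup_of_finiteDimensional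
      (T := A.toLinearMap) fun u w => hA u w)
  have hb : BddAbove (Set.range fun x : {x : Vec n // x ≠ 0} =>
      (RCLike.re (inner ℝ (A.toLinearMap x) (x : Vec n)) / ‖(x : Vec n)‖ ^ 2 : ℝ)) := by
    refine ⟨‖A‖, ?_⟩
    rintro _ ⟨x, rfl⟩
    exact le_of_abs_le (A.rayleighQuotient_le_norm x)
  have h2 := (le_ciSup hb ⟨d, hd⟩).trans h1
  have h3 : 0 < ‖d‖ ^ 2 := by positivity
  rw [div_le_iff₀ h3] at h2
  rw [real_inner_comm]
  exact h2

lemma lambdaMin_pos (hpos : ∀ d, d ≠ 0 → 0 < inner ℝ d (A d)) : 0 < lambdaMin A := by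
  have hne : {μ : ℝ | Module.End.HasEigenvalue A.toLinearMap μ}.Nonempty :=
    ⟨_, LinearMap.IsSymmetric.hasEigenvalue_iInf_of_finiteDimensional
      (T := A.toLinearMap) fun u w => hA u w⟩
  have hmem : Module.End.HasEigenvalue A.toLinearMap (lambdaMin A) :=
    hne.csInf_mem (Module.End.finite_hasEigenvalue A.toLinearMap)
  obtain ⟨d, hd⟩ := hmem.exists_hasEigenvector
  have h1 := hpos d hd.2
  have h2 : A d = lambdaMin A • d := hd.apply_eq_smul
  rw [h2, inner_smul_right, real_inner_self_eq_norm_sq] at h1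
  exact pos_of_mul_pos_left h1 (sq_nonneg _)

end Eigenvalues

/-! ### Taylor estimates -/

lemma norm_gradient_sub_sub_hess_le {g : Vec n → ℝ} (hg : ContDiff ℝ 2 g) {S : Set (Vec n)}
    (hS : Convex ℝ S) {x y : Vec n} (hx : x ∈ S) (hy : y ∈ S) {ε : ℝ}
    (hε : ∀ z ∈ S, ‖hess g z - hess g x‖ ≤ ε) :
    ‖gradient g y - gradient g x - hess g x (y - x)‖ ≤ ε * ‖y - x‖ :=
  hS.norm_image_sub_le_of_norm_hasFDerivWithin_le'
    (fun z _ => (hasFDerivAt_gradient hg z).hasFDerivWithinAt) hε hx hy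

/-- Mean value inequality on `[0, 1]` for `g` along the segment minus its quadratic Taylor
polynomial, whose derivative is controlled by the gradient estimate. This gives `ε` instead of the
sharp `ε / 2`, which is enough. -/
lemma abs_sub_sub_sub_le {g : Vec n → ℝ} (hg : ContDiff ℝ 2 g) {S : Set (Vec n)}
    (hS : Convex ℝ S) {x d : Vec n} (hx : x ∈ S) (hy : x + d ∈ S) {ε : ℝ}
    (hε : ∀ z ∈ S, ‖hess g z - hess g x‖ ≤ ε) :
    |g (x + d) - g x - inner ℝ (gradient g x) d - 1 / 2 * inner ℝ d (hess g x d)| ≤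
      ε * ‖d‖ ^ 2 := by
  have hε0 : 0 ≤ ε := (norm_nonneg _).trans (hε x hx)
  have hd : ∀ t : ℝ, HasDerivAt (fun t : ℝ => g (x + t • d) - t * inner ℝ (gradient g x) d
      - t ^ 2 / 2 * inner ℝ d (hess g x d))
      (inner ℝ (gradient g (x + t • d) - gradient g x - hess g x (t • d)) d) t := by
    intro t
    have h1 : HasDerivAt (fun t : ℝ => x + t • d) d t := by
      simpa using ((hasDerivAt_id t).smul_const d).const_add x
    have h2 : HasFDerivAt g (fderiv ℝ g (x + t • d)) (x + t • d) :=
      (hg.differentiable two_ne_zero _).hasFDerivAt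
    have h3 := h2.comp_hasDerivAt t h1
    have h4 := (hasDerivAt_id t).mul_const (inner ℝ (gradient g x) d)
    have h5 := ((hasDerivAt_pow 2 t).div_const 2).mul_const (inner ℝ d (hess g x d))
    refine ((h3.sub h4).sub h5).congr_deriv ?_
    rw [inner_sub_left, inner_sub_left, inner_gradient_left, map_smul, inner_smul_left,
      real_inner_comm d (hess g x d)]
    simp
  have hb : ∀ t ∈ Set.Icc (0 : ℝ) 1,
      ‖inner ℝ (gradient g (x + t • d) - gradient g x - hess g x (t • d)) d‖ ≤ ε * ‖d‖ ^ 2 := by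
    intro t ht
    have hmem : x + t • d ∈ S := by
      simpa using hS.add_smul_sub_mem hx hy ht
    have h1 := norm_gradient_sub_sub_hess_le hg hS hx hmem hε
    rw [add_sub_cancel_left] at h1
    have h2 : ‖t • d‖ ≤ ‖d‖ := by
      rw [norm_smul, Real.norm_of_nonneg ht.1]
      exact mul_le_of_le_one_left (norm_nonneg _) ht.2
    calc _ ≤ _ := norm_inner_le_norm _ _
      _ ≤ ε * ‖d‖ * ‖d‖ := by gcongr; exact h1.trans (by gcongr)
      _ = _ := by ring
  have := (convex_Icc (0 : ℝ) 1).norm_image_sub_le_of_norm_hasDerivWithin_le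
    (fun t _ => (hd t).hasDerivWithinAt) hb (Set.left_mem_Icc.2 zero_le_one)
    (Set.right_mem_Icc.2 zero_le_one)
  simp only [Real.norm_eq_abs, one_smul, zero_smul, add_zero, sub_zero, abs_one, mul_one] at this
  convert this using 2
  ring

/-! ### Pareto stationarity -/

lemma exists_inner_gradient_nonneg [NeZero m] {f : Fin m → Vec n → ℝ}
    (hf : ∀ h, ContDiff ℝ 2 (f h)) {x : Vec n} (hx : IsLocalParetoOptimal f x) (d : Vec n) :
    ∃ j, 0 ≤ inner ℝ (gradient (f j) x) d := by
  by_contra! hneg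
  obtain ⟨V, hV, hdom⟩ := hx
  have hcont : Tendsto (fun t : ℝ => x + t • d) (𝓝[>] 0) (𝓝 x) := by
    have : Tendsto (fun t : ℝ => x + t • d) (𝓝 0) (𝓝 (x + (0 : ℝ) • d)) :=
      Continuous.tendsto (by fun_prop) 0
    rw [zero_smul, add_zero] at this
    exact this.mono_left nhdsWithin_le_nhds
  have hdec : ∀ j, ∀ᶠ t : ℝ in 𝓝[>] 0, f j (x + t • d) < f j x := by
    intro j
    have h1 : HasDerivAt (fun t : ℝ => x + t • d) d 0 := by
      simpa using ((hasDerivAt_id (0 : ℝ)).smul_const d).const_add x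
    have h2 : HasFDerivAt (f j) (fderiv ℝ (f j) x) (x + (0 : ℝ) • d) := by
      rw [zero_smul, add_zero]
      exact ((hf j).differentiable two_ne_zero _).hasFDerivAt
    have h3 := h2.comp_hasDerivAt (0 : ℝ) h1
    have h4 := hneg j
    rw [inner_gradient_left] at h4
    have h5 := (hasDerivAt_iff_tendsto_slope.1 h3).eventually (gt_mem_nhds h4)
    have h6 : 𝓝[>] (0 : ℝ) ≤ 𝓝[≠] 0 := nhdsWithin_mono _ fun t ht => ne_of_gt ht
    filter_upwards [h6 h5, self_mem_nhdsWithin] with t ht ht0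
    have ht0' : (0 : ℝ) < t := ht0
    rw [slope_def_field, sub_zero, div_lt_iff₀ ht0', zero_mul] at ht
    simpa using ht
  obtain ⟨t, ht1, ht2⟩ := ((eventually_all.2 hdec).and (hcont.eventually hV)).exists
  exact hdom _ ht2 ⟨fun j => (ht1 j).le, 0, (ht1 0).ne⟩

/-- For each nearby `y ≠ x`, stationarity in the direction `y - x` provides an index, depending on
`y`, whose objective grows by at least `(a / 2 - ε) ‖y - x‖² > 0`. -/
lemma isLocalParetoOptimal_of_stationary {f : Fin m → Vec n → ℝ}
    (hf : ∀ h, ContDiff ℝ 2 (f h)) {x : Vec n} {a ε R : ℝ} (hR : 0 < R) (hε : 2 * ε < a)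
    (hstat : ∀ d, ∃ j, 0 ≤ inner ℝ (gradient (f j) x) d)
    (hH : ∀ j d, a * ‖d‖ ^ 2 ≤ inner ℝ d (hess (f j) x d))
    (hd : ∀ j, ∀ z ∈ Metric.ball x R, ‖hess (f j) z - hess (f j) x‖ ≤ ε) :
    IsLocalParetoOptimal f x := by
  refine ⟨Metric.ball x R, Metric.ball_mem_nhds x hR, ?_⟩
  rintro y hy ⟨hle, j', hj'⟩
  obtain ⟨j, hj⟩ := hstat (y - x)
  have hyx : y ≠ x := by rintro rfl; exact hj' rfl
  have h1 := abs_sub_sub_sub_le (hf j) (convex_ball x R) (d := y - x)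
    (Metric.mem_ball_self hR) (by simpa using hy) (hd j)
  rw [add_sub_cancel] at h1
  have h2 := neg_le_of_abs_le h1
  have h3 : 0 < ‖y - x‖ ^ 2 := by
    have := norm_pos_iff.2 (sub_ne_zero.2 hyx)
    positivity
  nlinarith [hH j (y - x), hle j]

/-! ### Steepest descent and Newton directions -/

section Directions

variable [NeZero m] {f : Fin m → Vec n → ℝ} {p : Params} {x : Vec n} {a A c : ℝ}

lemma steepestDir_isMin (f : Fin m → Vec n → ℝ) (x y : Vec n) :
    steepestModel f x (steepestDir f x) ≤ steepestModel f x y := by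
  obtain ⟨s, hs⟩ := exists_forall_quadModel_le (g := fun j => gradient (f j) x)
    (H := fun _ => ContinuousLinearMap.id ℝ (Vec n)) one_pos (fun j d => by simp)
  simp only [quadModel_id] at hs
  exact Classical.epsilon_spec (p := fun d => ∀ y, steepestModel f x d ≤ steepestModel f x y)
    ⟨s, hs⟩ y

lemma newtonDir_isMin (ha : 0 < a) (hH : ∀ j d, a * ‖d‖ ^ 2 ≤ inner ℝ d (hess (f j) x d))
    (y : Vec n) :
    quadModel (fun j => gradient (f j) x) (fun j => hess (f j) x) (newtonDir f x) ≤
      quadModel (fun j => gradient (f j) x) (fun j => hess (f j) x) y :=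
  Classical.epsilon_spec (p := fun d => ∀ y,
    quadModel (fun j => gradient (f j) x) (fun j => hess (f j) x) d ≤
      quadModel (fun j => gradient (f j) x) (fun j => hess (f j) x) y)
    (exists_forall_quadModel_le ha hH) y

/-- The model value at `v(x)` lies between `theta f x ≥ 0` and `-‖v(x)‖² / 2`. -/
lemma steepestDir_eq_zero (h : ¬ theta f x < 0) : steepestDir f x = 0 := by
  have h1 : theta f x ≤ steepestModel f x (steepestDir f x) :=
    ciInf_le ⟨_, by rintro _ ⟨y, rfl⟩; exact steepestDir_isMin f x y⟩ _
  have h2 : maxSlope f x (steepestDir f x) ≤ _ := maxInner_add_norm_sq_le (steepestDir_isMin f x)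
  have h3 : steepestModel f x (steepestDir f x) = maxSlope f x (steepestDir f x) +
    1 / 2 * ‖steepestDir f x‖ ^ 2 := rfl
  have h4 : ‖steepestDir f x‖ ^ 2 ≤ 0 := by linarith [not_lt.1 h]
  exact norm_eq_zero.1 (pow_eq_zero_iff two_ne_zero |>.1 (le_antisymm h4 (sq_nonneg _)))

lemma mul_norm_newtonDir_le_norm_steepestDir (ha : 0 < a)
    (hH : ∀ j d, a * ‖d‖ ^ 2 ≤ inner ℝ d (hess (f j) x d)) :
    a * ‖newtonDir f x‖ ≤ ‖steepestDir f x‖ :=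
  mul_norm_le_of_isMin (steepestDir_isMin f x) (newtonDir_isMin ha hH) hH

lemma mul_norm_newtonDir_le (ha : 0 < a) (hc : 0 ≤ c)
    (hH : ∀ j d, a * ‖d‖ ^ 2 ≤ inner ℝ d (hess (f j) x d))
    (h : ∀ d, ∃ j, - (c * ‖d‖) ≤ inner ℝ (gradient (f j) x) d) :
    a * ‖newtonDir f x‖ ≤ c :=
  (mul_norm_newtonDir_le_norm_steepestDir ha hH).trans
    (norm_le_of_forall_exists_inner (steepestDir_isMin f x) hc h)

lemma neg_mul_le_inner_of_norm_sub_le {u w d : Vec n} (h : 0 ≤ inner ℝ u d) (hc : ‖w - u‖ ≤ c) :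
    - (c * ‖d‖) ≤ inner ℝ w d := by
  have h1 := neg_le_of_abs_le (abs_real_inner_le_norm (w - u) d)
  have h2 := mul_le_mul_of_nonneg_right hc (norm_nonneg d)
  rw [inner_sub_left] at h1
  linarith

lemma mul_norm_newtonDir_le_of_stationary {x₀ : Vec n} (ha : 0 < a) (hc : 0 ≤ c)
    (hH : ∀ j d, a * ‖d‖ ^ 2 ≤ inner ℝ d (hess (f j) x d))
    (hstat : ∀ d, ∃ j, 0 ≤ inner ℝ (gradient (f j) x₀) d)
    (h : ∀ j, ‖gradient (f j) x - gradient (f j) x₀‖ ≤ c) :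
    a * ‖newtonDir f x‖ ≤ c :=
  mul_norm_newtonDir_le ha hc hH fun d =>
    (hstat d).imp fun j hj => neg_mul_le_inner_of_norm_sub_le hj (h j)

/-- The predicted gradients satisfy the optimality condition of the Newton subproblem exactly;
replacing them by the true gradients at the new point costs at most the prediction error `c`. -/
lemma exists_neg_le_inner_gradient_newton_step (hf : ∀ h, ContDiff ℝ 2 (f h)) (ha : 0 < a)
    (hH : ∀ j d, a * ‖d‖ ^ 2 ≤ inner ℝ d (hess (f j) x d))
    (h : ∀ j, ‖gradient (f j) (x + newtonDir f x) - gradient (f j) x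
      - hess (f j) x (newtonDir f x)‖ ≤ c) (d : Vec n) :
    ∃ j, - (c * ‖d‖) ≤ inner ℝ (gradient (f j) (x + newtonDir f x)) d :=
  (exists_inner_nonneg_of_isMin (newtonDir_isMin ha hH)
    (fun j => inner_hess_comm (hf j) x) d).imp fun j hj =>
      neg_mul_le_inner_of_norm_sub_le hj (by rw [← sub_sub]; exact h j)

lemma passesSafeguard_newtonDir (ha : 0 < a) (hA : 0 < A)
    (hH : ∀ j d, a * ‖d‖ ^ 2 ≤ inner ℝ d (hess (f j) x d))
    (hH' : ∀ j d, inner ℝ d (hess (f j) x d) ≤ A * ‖d‖ ^ 2)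
    (h₁ : p.Γ₁ ≤ 1 / (2 * A)) (h₂ : 1 / a ≤ p.Γ₂) :
    PassesSafeguard f p x (newtonDir f x) := by
  constructor
  · refine (maxInner_le_of_isMin hA ha.le (steepestDir_isMin f x) (newtonDir_isMin ha hH)
      hH hH').trans ?_
    exact mul_le_mul_of_nonneg_right (neg_le_neg h₁) (sq_nonneg _)
  · have h := mul_norm_newtonDir_le_norm_steepestDir ha hH
    calc ‖newtonDir f x‖ = 1 / a * (a * ‖newtonDir f x‖) := by field_simp
      _ ≤ p.Γ₂ * ‖steepestDir f x‖ := by gcongr; exact p.Γ₂_pos.le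

/-- Taylor bounds each increase by `q + ε ‖s‖²`, with `q` the optimal model value. Split `q = 2γ q +
(1 - 2γ) q`: the first part is at most `γ` times the maximal slope, and the second is negative
enough to absorb `ε ‖s‖²`. -/
lemma newtonDir_armijo (hf : ∀ h, ContDiff ℝ 2 (f h)) (ha : 0 < a)
    (hH : ∀ j d, a * ‖d‖ ^ 2 ≤ inner ℝ d (hess (f j) x d)) {ε γ : ℝ} (hγ₀ : 0 ≤ γ)
    (hγ : γ ≤ 1 / 2) (hε : ε ≤ (1 - 2 * γ) * (a / 2)) {S : Set (Vec n)} (hS : Convex ℝ S)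
    (hx : x ∈ S) (hx' : x + newtonDir f x ∈ S)
    (hd : ∀ j, ∀ z ∈ S, ‖hess (f j) z - hess (f j) x‖ ≤ ε) (j : Fin m) :
    f j (x + newtonDir f x) ≤ f j x + γ * maxSlope f x (newtonDir f x) := by
  have h1 := le_of_abs_le (abs_sub_sub_sub_le (hf j) hS hx hx' (hd j))
  have h2 := le_quadModel (fun j => gradient (f j) x) (fun j => hess (f j) x) (newtonDir f x) j
  have h3 := quadModel_le_neg_norm_sq (newtonDir_isMin ha hH) hH
  have h4 : _ ≤ maxSlope f x (newtonDir f x) :=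
    two_mul_quadModel_le_maxInner (newtonDir_isMin ha hH)
  have h5 := mul_le_mul_of_nonneg_right hε (sq_nonneg ‖newtonDir f x‖)
  have h6 := mul_le_mul_of_nonneg_left h4 hγ₀
  have h7 := mul_le_mul_of_nonneg_left h3 (by linarith : 0 ≤ 1 - 2 * γ)
  linarith

end Directions

lemma eta_eq_zero {κ : ℝ} {g : Vec n → ℝ} {x : Vec n} (h : 0 < lambdaMin (hess g x)) :
    eta κ g x = 0 :=
  if_neg (not_le.2 h)

lemma regNewtonDir_eq_newtonDir {κ : ℝ} {f : Fin m → Vec n → ℝ} {x : Vec n}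
    (h : ∀ j, eta κ (f j) x = 0) : regNewtonDir κ f x = newtonDir f x := by
  rw [regNewtonDir, newtonDir]
  congr 1
  funext j
  ext v
  simp [h]

/-! ### Refinement steps of an execution -/

/-- A generated pair certifies that its first point was processed and not skipped; only then is the
recorded step size constrained by the line search. -/
lemma PointLoop.isRefineStep {f : Fin m → Vec n → ℝ} {p : Params} {k : ℕ}
    {vD : Vec n → Vec n} {α : Vec n → ℝ} {L : List (Vec n)} {Y Y' : Set (Vec n)}
    {G : Vec n → Vec n → Prop} (h : PointLoop f p k vD α L Y Y' G) {u w : Vec n} (hG : G u w) :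
    IsRefineStep f p k u (refineDir f p k (vD u) u) (α u) := by
  induction h with
  | nil => exact hG.elim
  | skip _ _ _ _ _ _ _ ih => exact ih hG
  | process _ _ _ _ _ _ _ _ _ _ _ hstep _ _ _ _ _ ih =>
    rcases hG with ⟨rfl, _⟩ | hG
    · exact hstep
    · exact ih hG

lemma Run.IsLinked.isRefineStep {f : Fin m → Vec n → ℝ} {p : Params} {R : Run f p}
    {x : ℕ → Vec n} (h : R.IsLinked x) (k : ℕ) :
    IsRefineStep f p k (x k) (R.dir k (x k)) (R.α k (x k)) :=
  (R.iterate k).isRefineStep (h k).2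

lemma IsRefineStep.eq_one {f : Fin m → Vec n → ℝ} {p : Params} {k : ℕ} {x d : Vec n} {α : ℝ}
    (h : IsRefineStep f p k x d α) (hα₀ : p.α₀ = 1) (hθ : theta f x < - p.σ k)
    (harm : ∀ j, f j (x + d) ≤ f j x + p.γ * maxSlope f x d) : α = 1 := by
  refine (h.1 hθ).unique ⟨⟨⟨0, by simp [hα₀]⟩, by simpa using harm⟩, ?_⟩
  rintro _ ⟨⟨i, rfl⟩, _⟩
  rw [hα₀, one_mul]
  exact pow_le_one₀ p.δ_pos.le p.δ_lt_one.le

lemma refineDir_eq_of_passesSafeguard {f : Fin m → Vec n → ℝ} {p : Params} {k : ℕ}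
    {vD x d : Vec n} (hσ : p.σ k = 0) (hd : PassesSafeguard f p x d)
    (hvD : theta f x < 0 → vD = d) (h0 : ¬ theta f x < 0 → steepestDir f x = 0) :
    refineDir f p k vD x = d := by
  by_cases hθ : theta f x < 0
  · rw [refineDir, hvD hθ, if_pos ⟨by simpa [hσ] using hθ, hd⟩]
  · rw [refineDir, if_neg fun h => hθ (by simpa [hσ] using h.1), h0 hθ]
    -- With `v(x) = 0` the norm half of the safeguard forces `d = 0`, so the fallback direction
    -- coincides with `d`.
    have := hd.2
    rw [h0 hθ, norm_zero, mul_zero] at this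
    exact (norm_le_zero_iff.1 this).symm

/-! ### Iterations whose steps contract -/

section Contraction

variable {s : Vec n → Vec n} {B : Set (Vec n)} {y : ℕ → Vec n} {c : ℝ}

/-- The invariant is `dist (y i) (y 0) + 2 * ‖s (y i)‖ ≤ 2 * c`: a step adds at most `‖s (y i)‖` to
the distance, while the second term drops by at least `3/2 * ‖s (y i)‖`. -/
lemma contracting_steps (hy : ‖s (y 0)‖ ≤ c) (hB : Metric.closedBall (y 0) (2 * c) ⊆ B)
    (hs : ∀ x ∈ B, x + s x ∈ B → ‖s (x + s x)‖ ≤ 1 / 4 * ‖s x‖)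
    (hstep : ∀ i, y i ∈ B → y i + s (y i) ∈ B → y (i + 1) = y i + s (y i)) (i : ℕ) :
    y i ∈ Metric.closedBall (y 0) (2 * c) ∧ y i + s (y i) ∈ B ∧ y (i + 1) = y i + s (y i) ∧
      ‖s (y (i + 1))‖ ≤ 1 / 4 * ‖s (y i)‖ := by
  have key : ∀ i, dist (y i) (y 0) + 2 * ‖s (y i)‖ ≤ 2 * c → y i ∈ Metric.closedBall (y 0) (2 * c) ∧
      y i + s (y i) ∈ B ∧ y (i + 1) = y i + s (y i) ∧
      ‖s (y (i + 1))‖ ≤ 1 / 4 * ‖s (y i)‖ := by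
    intro i hi
    have h0 := norm_nonneg (s (y i))
    have h1 : y i ∈ Metric.closedBall (y 0) (2 * c) := by
      rw [Metric.mem_closedBall]; linarith
    have h2 : y i + s (y i) ∈ B := by
      refine hB ?_
      rw [Metric.mem_closedBall]
      have := dist_triangle (y i + s (y i)) (y i) (y 0)
      rw [dist_self_add_left] at this
      linarith
    have h3 := hstep i (hB h1) h2
    refine ⟨h1, h2, h3, ?_⟩
    rw [h3]
    exact hs _ (hB h1) h2
  have hinv : ∀ i, dist (y i) (y 0) + 2 * ‖s (y i)‖ ≤ 2 * c := by
    intro i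
    induction i with
    | zero => rw [dist_self]; linarith
    | succ i ih =>
      obtain ⟨-, -, h3, h4⟩ := key i ih
      have := dist_triangle (y (i + 1)) (y i) (y 0)
      have h5 : dist (y (i + 1)) (y i) = ‖s (y i)‖ := by rw [h3, dist_self_add_left]
      linarith [norm_nonneg (s (y i))]
  exact key i (hinv i)

lemma exists_limit_of_contracting (hstep : ∀ i, y (i + 1) = y i + s (y i))
    (hs : ∀ i, ‖s (y (i + 1))‖ ≤ 1 / 4 * ‖s (y i)‖) :
    ∃ z, Tendsto y atTop (𝓝 z) ∧ (∀ i, dist (y i) z ≤ 2 * ‖s (y i)‖) ∧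
      ∀ i, ‖s (y i)‖ ≤ 2 * dist (y i) z := by
  have hpow : ∀ i l, ‖s (y (i + l))‖ ≤ ‖s (y i)‖ / 2 ^ l := by
    intro i l
    induction l with
    | zero => simp
    | succ l ih =>
      have := hs (i + l)
      rw [← add_assoc, pow_succ, ← div_div]
      linarith [norm_nonneg (s (y (i + l)))]
  have hdist : ∀ i l, dist (y (i + l)) (y (i + l + 1)) ≤ 2 * ‖s (y i)‖ / 2 / 2 ^ l := by
    intro i l
    rw [hstep, dist_self_add_right]
    simpa using hpow i l
  have hc : CauchySeq y :=
    cauchySeq_of_le_geometric_two (C := 2 * ‖s (y 0)‖) fun l => by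
      simpa only [zero_add] using hdist 0 l
  obtain ⟨z, hz⟩ := cauchySeq_tendsto_of_complete hc
  have hle : ∀ i, dist (y i) z ≤ 2 * ‖s (y i)‖ := fun i =>
    dist_le_of_le_geometric_two_of_tendsto₀ (f := fun l => y (i + l)) (hdist i)
      (by simpa only [add_comm i] using (tendsto_add_atTop_iff_nat i).2 hz)
  refine ⟨z, hz, hle, fun i => ?_⟩
  -- The factor `1/4` matters here: `‖s (y i)‖` is at most `dist (y i) z + 2 * ‖s (y (i + 1))‖`, and
  -- the last term is at most half of `‖s (y i)‖`.
  have h1 := dist_triangle_right (y (i + 1)) (y i) z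
  rw [hstep, dist_self_add_left, ← hstep] at h1
  linarith [hle (i + 1), hs i]

end Contraction

/-! ### Neighbourhoods with uniform Hessian bounds -/

lemma exists_ball_hess_bounds [NeZero n] [NeZero m] {f : Fin m → Vec n → ℝ}
    (hf : ∀ h, ContDiff ℝ 2 (f h)) {p : Params} (hγ : p.γ < 1 / 2) {xbar : Vec n}
    (hpos : ∀ h, ∀ d : Vec n, d ≠ 0 → 0 < inner ℝ d (hess (f h) xbar d))
    {ω : ℝ} (hω₀ : 0 < ω) (hω₁ : ω < 1)
    (hΓ₁ : p.Γ₁ ≤ ω ^ 3 / 2 *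
      ((⨅ h, lambdaMin (hess (f h) xbar)) / (⨆ h, lambdaMax (hess (f h) xbar) ^ 2)))
    (hΓ₂ : 1 / (ω * ⨅ h, lambdaMin (hess (f h) xbar)) ≤ p.Γ₂)
    {U : Set (Vec n)} (hU : U ∈ 𝓝 xbar) :
    ∃ R a A ε : ℝ, 0 < R ∧ 0 < a ∧ 0 < A ∧ 0 ≤ ε ∧ Metric.ball xbar R ⊆ U ∧
      p.Γ₁ ≤ 1 / (2 * A) ∧ 1 / a ≤ p.Γ₂ ∧ ε ≤ (1 - 2 * p.γ) * (a / 2) ∧ 4 * ε ≤ a ∧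
      (∀ x ∈ Metric.ball xbar R, ∀ j d, a * ‖d‖ ^ 2 ≤ inner ℝ d (hess (f j) x d)) ∧
      (∀ x ∈ Metric.ball xbar R, ∀ j d, inner ℝ d (hess (f j) x d) ≤ A * ‖d‖ ^ 2) ∧
      ∀ x ∈ Metric.ball xbar R, ∀ j, ∀ z ∈ Metric.ball xbar R,
        ‖hess (f j) z - hess (f j) x‖ ≤ ε := by
  set l := ⨅ h, lambdaMin (hess (f h) xbar) with hl
  set M := ⨆ h, lambdaMax (hess (f h) xbar) ^ 2 with hM
  have hl0 : 0 < l := by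
    obtain ⟨h, hh⟩ := exists_eq_ciInf_of_finite (f := fun h => lambdaMin (hess (f h) xbar))
    rw [hl, ← hh]
    exact lambdaMin_pos (inner_hess_comm (hf h) xbar) (hpos h)
  have hlow : ∀ j d, l * ‖d‖ ^ 2 ≤ inner ℝ d (hess (f j) xbar d) := fun j d =>
    (mul_le_mul_of_nonneg_right (ciInf_le (Set.finite_range _).bddBelow j) (sq_nonneg _)).trans
      (lambdaMin_mul_le (inner_hess_comm (hf j) xbar) d)
  -- `M` is a supremum of squares, so its root bounds every largest eigenvalue.
  have hup : ∀ j d, inner ℝ d (hess (f j) xbar d) ≤ √M * ‖d‖ ^ 2 := fun j d =>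
    (le_lambdaMax_mul (inner_hess_comm (hf j) xbar) d).trans
      (mul_le_mul_of_nonneg_right (Real.le_sqrt_of_sq_le
        (le_iSup_fin (fun h => lambdaMax (hess (f h) xbar) ^ 2) j)) (sq_nonneg _))
  have hlL : l ≤ √M := by
    obtain ⟨d, hd⟩ := exists_ne (0 : Vec n)
    have : 0 < ‖d‖ ^ 2 := by have := norm_pos_iff.2 hd; positivity
    exact le_of_mul_le_mul_right ((hlow 0 d).trans (hup 0 d)) this
  have hL0 : 0 < √M := hl0.trans_le hlL
  have hMsq : √M ^ 2 = M := Real.sq_sqrt (Real.sqrt_pos.1 hL0).le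
  set L := √M
  -- The three bounds serve, in order, the spectral bounds `a = ω * l` and `A = L / ω`, the Armijo
  -- condition, and `4 * ε ≤ a`. Here `ε = 2 * e`, because two Hessians in the ball are compared
  -- through the one at `xbar`.
  set e := min ((1 - ω) * l) (min ((1 - 2 * p.γ) * (ω * l / 4)) (ω * l / 8)) with he
  have he1 : e ≤ (1 - ω) * l := min_le_left _ _
  have he2 : e ≤ (1 - 2 * p.γ) * (ω * l / 4) := (min_le_right _ _).trans (min_le_left _ _)
  have he3 : e ≤ ω * l / 8 := (min_le_right _ _).trans (min_le_right _ _)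
  have he0 : 0 < e := by
    have h1 : 0 < 1 - ω := sub_pos.2 hω₁
    have h2 : 0 < 1 - 2 * p.γ := by linarith
    exact lt_min (by positivity) (lt_min (by positivity) (by positivity))
  have hev : ∀ᶠ x in 𝓝 xbar, x ∈ U ∧ ∀ j, ‖hess (f j) x - hess (f j) xbar‖ ≤ e := by
    refine (eventually_mem_set.2 hU).and (eventually_all.2 fun j => ?_)
    filter_upwards [((continuous_hess (hf j)).tendsto xbar).eventually
      (Metric.ball_mem_nhds _ he0)] with x hx
    rw [dist_eq_norm] at hx
    exact hx.le
  obtain ⟨R, hR, hball⟩ := Metric.eventually_nhds_iff_ball.1 hev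
  refine ⟨R, ω * l, L / ω, 2 * e, hR, by positivity, by positivity, by positivity,
    fun x hx => (hball x hx).1, ?_, hΓ₂, by linarith, by linarith, ?_, ?_, ?_⟩
  · refine hΓ₁.trans ?_
    rw [← hMsq]
    -- Only `ω ^ 3 ≤ ω` and `l ≤ L` are needed to reach `1 / (2 * A)`.
    have h1 : ω ^ 3 ≤ ω := pow_le_of_le_one hω₀.le hω₁.le three_ne_zero
    calc ω ^ 3 / 2 * (l / L ^ 2) ≤ ω / 2 * (L / L ^ 2) := by gcongr
      _ = 1 / (2 * (L / ω)) := by field_simp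
  · intro x hx j d
    have h1 := neg_le_of_abs_le (abs_inner_sub_le ((hball x hx).2 j) d)
    have h2 := mul_le_mul_of_nonneg_right he1 (sq_nonneg ‖d‖)
    linarith [hlow j d]
  · intro x hx j d
    have h1 := le_of_abs_le (abs_inner_sub_le ((hball x hx).2 j) d)
    have h2 : e ≤ L / ω - L := by
      rw [le_sub_iff_add_le, le_div_iff₀ hω₀]
      nlinarith [mul_le_mul_of_nonneg_left hlL (sub_pos.2 hω₁).le]
    have h3 := mul_le_mul_of_nonneg_right h2 (sq_nonneg ‖d‖)
    linarith [hup j d]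
  · intro x hx j z hz
    have h1 := norm_sub_le_norm_sub_add_norm_sub (hess (f j) z) (hess (f j) xbar) (hess (f j) x)
    rw [norm_sub_rev (hess (f j) xbar)] at h1
    linarith [(hball x hx).2 j, (hball z hz).2 j]

/-! ### Convergence rates -/

lemma ball_ssubset_ball {n : ℕ} [NeZero n] {x y : Vec n} {r R : ℝ} (hR : 0 < R)
    (h : dist y x + r ≤ R / 2) : Metric.ball y r ⊂ Metric.ball x R := by
  refine (Set.ssubset_iff_of_subset (Metric.ball_subset_ball' (by linarith))).2 ?_
  -- A point at distance `R / 2` from `x` lies in the large ball, and the triangle inequality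
  -- excludes it from the small one.
  obtain ⟨d, hd⟩ := exists_norm_eq (Vec n) (c := R / 2) (by linarith)
  refine ⟨x + d, ?_, fun hmem => ?_⟩
  · rw [Metric.mem_ball, dist_self_add_left, hd]; linarith
  · have := dist_triangle_right (x + d) x y
    have h' := Metric.mem_ball.1 hmem
    have h2 := dist_triangle (x + d) y x
    rw [dist_self_add_left, hd] at h2
    linarith

/-- `hc` says that the error of the linear prediction of the gradients at `x_{k+1}` bounds the step
from `x_{k+1}`. -/
lemma convergesSuperlinearly_of_newton {n m : ℕ} {f : Fin m → Vec n → ℝ}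
    (hf : ∀ h, ContDiff ℝ 2 (f h)) {x : ℕ → Vec n} {z : Vec n} {s : Vec n → Vec n} {a : ℝ}
    (ha : 0 < a) {k₀ : ℕ} (hz : Tendsto x atTop (𝓝 z))
    (hstep : ∀ k ≥ k₀, x (k + 1) = x k + s (x k))
    (hle : ∀ k ≥ k₀, dist (x k) z ≤ 2 * ‖s (x k)‖)
    (hge : ∀ k ≥ k₀, ‖s (x k)‖ ≤ 2 * dist (x k) z)
    (hc : ∀ k ≥ k₀, ∀ c : ℝ, 0 ≤ c →
      (∀ j, ‖gradient (f j) (x (k + 1)) - gradient (f j) (x k)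
        - hess (f j) (x k) (x (k + 1) - x k)‖ ≤ c) → a * ‖s (x (k + 1))‖ ≤ c) :
    ConvergesSuperlinearly x z := by
  refine ⟨hz, isLittleO_iff.2 fun e he => ?_⟩
  -- Comparing Hessians through `z` doubles `a * e / 8`; the two factors `2` between step and
  -- distance then turn `e / 4` into `e`.
  have hev : ∀ᶠ w in 𝓝 z, ∀ j, ‖hess (f j) w - hess (f j) z‖ ≤ a * e / 8 := by
    refine eventually_all.2 fun j => ?_
    filter_upwards [((continuous_hess (hf j)).tendsto z).eventually
      (Metric.ball_mem_nhds _ (by positivity : 0 < a * e / 8))] with w hw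
    rw [dist_eq_norm] at hw
    exact hw.le
  obtain ⟨R, hR, hball⟩ := Metric.eventually_nhds_iff_ball.1 hev
  have hx : ∀ᶠ k in atTop, x k ∈ Metric.ball z R := hz.eventually (Metric.ball_mem_nhds z hR)
  filter_upwards [hx, (tendsto_add_atTop_nat 1).eventually hx, eventually_ge_atTop k₀]
    with k h1 h2 hk
  have h3 : ∀ j, ‖gradient (f j) (x (k + 1)) - gradient (f j) (x k)
      - hess (f j) (x k) (x (k + 1) - x k)‖ ≤ a * e / 4 * ‖s (x k)‖ := by
    intro j
    have := norm_gradient_sub_sub_hess_le (hf j) (convex_ball z R) h1 h2 (ε := a * e / 4) ?_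
    · rwa [show ‖x (k + 1) - x k‖ = ‖s (x k)‖ by rw [hstep k hk, add_sub_cancel_left]] at this
    · intro w hw
      have h4 := norm_sub_le_norm_sub_add_norm_sub (hess (f j) w) (hess (f j) z)
        (hess (f j) (x k))
      rw [norm_sub_rev (hess (f j) z)] at h4
      linarith [hball w hw j, hball _ h1 j]
  have h4 := hc k hk _ (by positivity) h3
  have h5 := hle (k + 1) (by omega)
  have h6 := mul_le_mul_of_nonneg_left (hge k hk) (by positivity : 0 ≤ e / 4)
  have h7 : ‖s (x (k + 1))‖ ≤ e / 4 * ‖s (x k)‖ := le_of_mul_le_mul_left (by linarith) ha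
  rw [norm_norm, norm_norm, ← dist_eq_norm, ← dist_eq_norm]
  linarith

lemma convergesQuadratically_of_newton {n m : ℕ} {f : Fin m → Vec n → ℝ}
    (hf : ∀ h, ContDiff ℝ 2 (f h)) {x : ℕ → Vec n} {z : Vec n} {s : Vec n → Vec n} {a : ℝ}
    (ha : 0 < a) {k₀ : ℕ} (hz : Tendsto x atTop (𝓝 z))
    (hstep : ∀ k ≥ k₀, x (k + 1) = x k + s (x k))
    (hle : ∀ k ≥ k₀, dist (x k) z ≤ 2 * ‖s (x k)‖)
    (hge : ∀ k ≥ k₀, ‖s (x k)‖ ≤ 2 * dist (x k) z)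
    (hc : ∀ k ≥ k₀, ∀ c : ℝ, 0 ≤ c →
      (∀ j, ‖gradient (f j) (x (k + 1)) - gradient (f j) (x k)
        - hess (f j) (x k) (x (k + 1) - x k)‖ ≤ c) → a * ‖s (x (k + 1))‖ ≤ c)
    {N : Set (Vec n)} (hN : Convex ℝ N) (hxN : ∀ k ≥ k₀, x k ∈ N)
    (hlip : ∀ h, ∃ K, LipschitzOnWith K (hess (f h)) N) :
    ConvergesQuadratically x z := by
  choose K hK using hlip
  set C : ℝ := ∑ j, (K j : ℝ) with hC
  have hC0 : 0 ≤ C := Finset.sum_nonneg fun j _ => (K j).2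
  refine ⟨hz, IsBigO.of_bound (8 * C / a) ?_⟩
  filter_upwards [eventually_ge_atTop k₀] with k hk
  have hxk := hxN k hk
  have hxk' := hxN (k + 1) (by omega)
  have h3 : ∀ j, ‖gradient (f j) (x (k + 1)) - gradient (f j) (x k)
      - hess (f j) (x k) (x (k + 1) - x k)‖ ≤ C * ‖s (x k)‖ * ‖s (x k)‖ := by
    intro j
    have hs : ‖x (k + 1) - x k‖ = ‖s (x k)‖ := by rw [hstep k hk, add_sub_cancel_left]
    -- On the segment between consecutive iterates the Hessian varies by at most a multiple of the
    -- step length, which makes the prediction error quadratic.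
    have := norm_gradient_sub_sub_hess_le (hf j) (convex_segment (𝕜 := ℝ) (x k) (x (k + 1)))
      (left_mem_segment ℝ _ _) (right_mem_segment ℝ _ _) (ε := C * ‖s (x k)‖) ?_
    · rwa [hs] at this
    · intro w hw
      have h4 := (hK j).norm_sub_le (hN.segment_subset hxk hxk' hw) hxk
      have h5 : ‖w - x k‖ ≤ ‖s (x k)‖ := by
        rw [← hs]
        obtain ⟨t, ht, rfl⟩ := segment_eq_image' ℝ (x k) (x (k + 1)) ▸ hw
        rw [add_sub_cancel_left, norm_smul, Real.norm_of_nonneg ht.1]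
        exact mul_le_of_le_one_left (norm_nonneg _) ht.2
      have h6 : (K j : ℝ) ≤ C :=
        Finset.single_le_sum (f := fun j => (K j : ℝ)) (fun j _ => (K j).2) (Finset.mem_univ j)
      exact h4.trans (mul_le_mul h6 h5 (norm_nonneg _) hC0)
  have h4 := hc k hk _ (by positivity) h3
  have h5 := hle (k + 1) (by omega)
  have h6 := hge k hk
  have h7 : ‖s (x (k + 1))‖ ≤ C * ‖s (x k)‖ * ‖s (x k)‖ / a := by
    rw [le_div_iff₀ ha]; linarith
  rw [norm_norm, Real.norm_of_nonneg (sq_nonneg _), ← dist_eq_norm, ← dist_eq_norm]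
  calc dist (x (k + 1)) z ≤ 2 * (C * ‖s (x k)‖ * ‖s (x k)‖ / a) := by linarith
    _ ≤ 2 * (C * (2 * dist (x k) z) * (2 * dist (x k) z) / a) := by gcongr
    _ = 8 * C / a * dist (x k) z ^ 2 := by ring

end FrontDescent

end

/-! ### Local convergence of the refinement iterates -/

open FrontDescent

theorem mainTheorem6 {n m : ℕ} (hn : 0 < n) (hm : 0 < m)
    (f : Fin m → Vec n → ℝ) (hf : ∀ h, ContDiff ℝ 2 (f h))
    (p : Params) (hσ : ∀ k, p.σ k = 0) (hα₀ : p.α₀ = 1) (hγ : p.γ < 1 / 2)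
    (κ : ℝ) (hκ : 0 < κ)
    (xbar : Vec n) (hxbar : IsLocalParetoOptimal f xbar)
    (hpos : ∀ h, ∀ d : Vec n, d ≠ 0 → 0 < inner ℝ d (hess (f h) xbar d))
    (ω : ℝ) (hω₀ : 0 < ω) (hω₁ : ω < 1)
    (hΓ₁ : p.Γ₁ ≤ ω ^ 3 / 2 *
      ((⨅ h, lambdaMin (hess (f h) xbar)) / (⨆ h, lambdaMax (hess (f h) xbar) ^ 2)))
    (hΓ₂ : 1 / (ω * ⨅ h, lambdaMin (hess (f h) xbar)) ≤ p.Γ₂)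
    (U : Set (Vec n)) (hU : U ∈ 𝓝 xbar) :
    ∃ N ∈ 𝓝 xbar, N ⊆ U ∧ ∃ ρ r : ℝ, 0 < ρ ∧ ρ ≤ r ∧ Metric.ball xbar ρ ⊂ N ∧
      ∀ (R : Run f p) (x : ℕ → Vec n), R.IsRefining x →
        (∀ k, theta f (x k) < 0 → R.vD k (x k) = regNewtonDir κ f (x k)) →
        ∀ kbar : ℕ, (∀ k ≥ kbar, x (k + 1) = R.refined k (x k)) →
        x kbar ∈ Metric.ball xbar ρ →
          Metric.ball (x kbar) r ⊂ N ∧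
          (∀ k ≥ kbar,
            ((∀ h, eta κ (f h) (x k) = 0) ∧ regNewtonDir κ f (x k) = newtonDir f (x k)) ∧
            (PassesSafeguard f p (x k) (regNewtonDir κ f (x k)) ∧
              R.dir k (x k) = regNewtonDir κ f (x k)) ∧
            (theta f (x k) < 0 → R.α k (x k) = 1) ∧
            x k ∈ Metric.ball (x kbar) r) ∧
          ∃ xstar ∈ Metric.ball (x kbar) r,
            IsLocalParetoOptimal f xstar ∧
            ConvergesSuperlinearly x xstar ∧
            ((∀ h, ∃ K, LipschitzOnWith K (hess (f h)) N) → ConvergesQuadratically x xstar) := by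
  have : NeZero n := ⟨hn.ne'⟩
  have : NeZero m := ⟨hm.ne'⟩
  obtain ⟨R, a, A, ε, hR, ha, hA, hε, hRU, hΓ₁', hΓ₂', hεγ, hεa, hlow, hup, hvar⟩ :=
    exists_ball_hess_bounds hf hγ hpos hω₀ hω₁ hΓ₁ hΓ₂ hU
  set B := Metric.ball xbar R with hB
  have hstat := exists_inner_gradient_nonneg hf hxbar
  -- With `xbar` stationary, this makes the first Newton step at most `R / 16`, so the iterates stay
  -- within `R / 8` of `x kbar`, inside the ball of radius `r = R / 4`.
  have hgrad : ∀ᶠ x in 𝓝 xbar, ∀ j, ‖gradient (f j) x - gradient (f j) xbar‖ ≤ a * (R / 16) := by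
    refine eventually_all.2 fun j => ?_
    filter_upwards [((contDiff_gradient (hf j)).continuous.tendsto xbar).eventually
      (Metric.ball_mem_nhds _ (by positivity : 0 < a * (R / 16)))] with w hw
    rw [dist_eq_norm] at hw
    exact hw.le
  obtain ⟨ρ₀, hρ₀, hball⟩ := Metric.eventually_nhds_iff_ball.1 hgrad
  have hρR : min ρ₀ (R / 4) ≤ R / 4 := min_le_right _ _
  refine ⟨B, Metric.ball_mem_nhds xbar hR, hRU, min ρ₀ (R / 4), R / 4,
    lt_min hρ₀ (by positivity), hρR, ball_ssubset_ball hR (by rw [dist_self]; linarith), ?_⟩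
  intro Q x hx hvD kbar hkbar hxk
  have hxk₀ : x kbar ∈ Metric.ball xbar ρ₀ := Metric.ball_subset_ball (min_le_left _ _) hxk
  have hxk₁ : dist (x kbar) xbar < R / 4 := (Metric.mem_ball.1 hxk).trans_le hρR
  have hball_r : Metric.ball (x kbar) (R / 4) ⊂ B := ball_ssubset_ball hR (by linarith)
  have hreg : ∀ y ∈ B, (∀ h, eta κ (f h) y = 0) ∧ regNewtonDir κ f y = newtonDir f y := by
    intro y hy
    have h0 : ∀ h, eta κ (f h) y = 0 := fun h => by
      refine eta_eq_zero (lambdaMin_pos (inner_hess_comm (hf h) y) fun d hd => ?_)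
      have := norm_pos_iff.2 hd
      exact lt_of_lt_of_le (by positivity) (hlow y hy h d)
    exact ⟨h0, regNewtonDir_eq_newtonDir h0⟩
  have hsafe : ∀ y ∈ B, PassesSafeguard f p y (newtonDir f y) := fun y hy =>
    passesSafeguard_newtonDir ha hA (hlow y hy) (hup y hy) hΓ₁' hΓ₂'
  have hdir : ∀ k, x k ∈ B → Q.dir k (x k) = newtonDir f (x k) := fun k hk =>
    refineDir_eq_of_passesSafeguard (hσ k) (hsafe _ hk)
      (fun h => (hvD k h).trans (hreg _ hk).2) steepestDir_eq_zero
  have hα : ∀ k, x k ∈ B → x k + newtonDir f (x k) ∈ B → theta f (x k) < 0 →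
      Q.α k (x k) = 1 := by
    intro k hk hk' hθ
    have hstep := hx.1.isRefineStep k
    rw [hdir k hk] at hstep
    exact hstep.eq_one hα₀ (by simpa [hσ] using hθ)
      (newtonDir_armijo hf ha (hlow _ hk) p.γ_pos.le hγ.le hεγ (convex_ball xbar R) hk hk'
        (hvar _ hk))
  have hnext : ∀ k ≥ kbar, x k ∈ B → x k + newtonDir f (x k) ∈ B →
      x (k + 1) = x k + newtonDir f (x k) := by
    intro k hkk hk hk'
    rw [hkbar k hkk, Run.refined, hdir k hk]
    by_cases hθ : theta f (x k) < 0
    · rw [hα k hk hk' hθ, one_smul]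
    -- Without a line search the Newton direction is zero, so the recorded step size is irrelevant.
    · have h0 := (hsafe _ hk).2
      rw [steepestDir_eq_zero hθ, norm_zero, mul_zero] at h0
      rw [norm_le_zero_iff.1 h0, smul_zero]
  have hpred : ∀ y ∈ B, y + newtonDir f y ∈ B → ∀ c : ℝ, 0 ≤ c →
      (∀ j, ‖gradient (f j) (y + newtonDir f y) - gradient (f j) y
        - hess (f j) y (newtonDir f y)‖ ≤ c) → a * ‖newtonDir f (y + newtonDir f y)‖ ≤ c :=
    fun y hy hy' c hc h => mul_norm_newtonDir_le ha hc (hlow _ hy')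
      (exists_neg_le_inner_gradient_newton_step hf ha (hlow _ hy) h)
  have herr : ∀ y ∈ B, y + newtonDir f y ∈ B → ∀ j,
      ‖gradient (f j) (y + newtonDir f y) - gradient (f j) y - hess (f j) y (newtonDir f y)‖ ≤
        ε * ‖newtonDir f y‖ := fun y hy hy' j => by
    simpa only [add_sub_cancel_left] using
      norm_gradient_sub_sub_hess_le (hf j) (convex_ball xbar R) hy hy' (hvar y hy j)
  have hcontr : ∀ y ∈ B, y + newtonDir f y ∈ B →
      ‖newtonDir f (y + newtonDir f y)‖ ≤ 1 / 4 * ‖newtonDir f y‖ := by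
    intro y hy hy'
    have h := hpred y hy hy' _ (by positivity) (herr y hy hy')
    -- The bound `ε ‖s‖` on the prediction error and `4 * ε ≤ a` give the factor `1/4`.
    refine le_of_mul_le_mul_left (h.trans ?_) ha
    nlinarith [norm_nonneg (newtonDir f y)]
  have hinit : ‖newtonDir f (x kbar)‖ ≤ R / 16 := by
    refine le_of_mul_le_mul_left ?_ ha
    exact mul_norm_newtonDir_le_of_stationary ha (by positivity)
      (hlow _ (Metric.ball_subset_ball (by linarith) hxk)) hstat (hball _ hxk₀)
  have hsub : Metric.closedBall (x kbar) (2 * (R / 16)) ⊆ Metric.ball (x kbar) (R / 4) :=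
    Metric.closedBall_subset_ball (by linarith)
  have hiter := contracting_steps (y := fun i => x (kbar + i)) (s := newtonDir f) hinit
    (hsub.trans hball_r.subset) hcontr fun i h1 h2 => hnext (kbar + i) (by omega) h1 h2
  obtain ⟨z, hz, hle, hge⟩ := exists_limit_of_contracting (y := fun i => x (kbar + i))
    (s := newtonDir f) (fun i => (hiter i).2.2.1) fun i => (hiter i).2.2.2
  have hiter' : ∀ k ≥ kbar, x k ∈ Metric.ball (x kbar) (R / 4) ∧
      x k + newtonDir f (x k) ∈ B ∧ x (k + 1) = x k + newtonDir f (x k) ∧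
      dist (x k) z ≤ 2 * ‖newtonDir f (x k)‖ ∧ ‖newtonDir f (x k)‖ ≤ 2 * dist (x k) z := by
    intro k hk
    obtain ⟨i, rfl⟩ := Nat.exists_eq_add_of_le hk
    exact ⟨hsub (hiter i).1, (hiter i).2.1, (hiter i).2.2.1, hle i, hge i⟩
  have hxB : ∀ k ≥ kbar, x k ∈ B := fun k hk => hball_r.subset (hiter' k hk).1
  have hxz : Tendsto x atTop (𝓝 z) :=
    (tendsto_add_atTop_iff_nat kbar).1 (by simpa only [add_comm kbar] using hz)
  have hzr : z ∈ Metric.ball (x kbar) (R / 4) := by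
    rw [Metric.mem_ball']
    linarith [(hiter' kbar le_rfl).2.2.2.1]
  have hzB : z ∈ B := hball_r.subset hzr
  have hc : ∀ k ≥ kbar, ∀ c : ℝ, 0 ≤ c →
      (∀ j, ‖gradient (f j) (x (k + 1)) - gradient (f j) (x k)
        - hess (f j) (x k) (x (k + 1) - x k)‖ ≤ c) → a * ‖newtonDir f (x (k + 1))‖ ≤ c := by
    intro k hk c hc h
    rw [(hiter' k hk).2.2.1, add_sub_cancel_left] at h
    rw [(hiter' k hk).2.2.1]
    exact hpred _ (hxB k hk) (hiter' k hk).2.1 c hc h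
  have hzstat : ∀ d, ∃ j, 0 ≤ inner ℝ (gradient (f j) z) d := by
    intro d
    -- The index in the approximate stationarity of `x (k + 1)` may change with `k`. Assuming all
    -- slopes at `z` negative makes them uniformly negative for large `k`, even after adding the
    -- vanishing error `ε * ‖x (k + 1) - x k‖ * ‖d‖`.
    by_contra! hneg
    have hz' := hxz.comp (tendsto_add_atTop_nat 1)
    have hlim : ∀ j, Tendsto (fun k => inner ℝ (gradient (f j) (x (k + 1))) d
        + ε * ‖x (k + 1) - x k‖ * ‖d‖) atTop
        (𝓝 (inner ℝ (gradient (f j) z) d + ε * ‖z - z‖ * ‖d‖)) := fun j =>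
      ((((contDiff_gradient (hf j)).continuous.tendsto z).comp hz').inner tendsto_const_nhds).add
        (((hz'.sub hxz).norm.const_mul ε).mul_const ‖d‖)
    have hev : ∀ j, ∀ᶠ k in atTop, inner ℝ (gradient (f j) (x (k + 1))) d
        + ε * ‖x (k + 1) - x k‖ * ‖d‖ < 0 := fun j =>
      (hlim j).eventually (gt_mem_nhds (by simpa using hneg j))
    obtain ⟨k, hk, hkk⟩ := ((eventually_all.2 hev).and (eventually_ge_atTop kbar)).exists
    obtain ⟨j, hj⟩ := exists_neg_le_inner_gradient_newton_step hf ha (hlow _ (hxB k hkk))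
      (herr _ (hxB k hkk) (hiter' k hkk).2.1) d
    have := hk j
    rw [(hiter' k hkk).2.2.1, add_sub_cancel_left] at this
    linarith
  refine ⟨hball_r, fun k hk => ?_, z, hzr, ?_, ?_, ?_⟩
  · have hkB := hxB k hk
    rw [(hreg _ hkB).2]
    exact ⟨⟨(hreg _ hkB).1, rfl⟩, ⟨hsafe _ hkB, hdir k hkB⟩, hα k hkB (hiter' k hk).2.1,
      (hiter' k hk).1⟩
  · obtain ⟨δ, hδ, hδB⟩ := Metric.isOpen_iff.1 Metric.isOpen_ball z hzB
    exact isLocalParetoOptimal_of_stationary hf hδ (by linarith) hzstat (hlow z hzB)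
      fun j w hw => hvar z hzB j w (hδB hw)
  · exact convergesSuperlinearly_of_newton hf ha hxz (fun k hk => (hiter' k hk).2.2.1)
      (fun k hk => (hiter' k hk).2.2.2.1) (fun k hk => (hiter' k hk).2.2.2.2) hc
  · exact convergesQuadratically_of_newton hf ha hxz (fun k hk => (hiter' k hk).2.2.1)
      (fun k hk => (hiter' k hk).2.2.2.1) (fun k hk => (hiter' k hk).2.2.2.2) hc
      (convex_ball xbar R) hxB
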